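/- **Theorem (Equivalence of C-LMP and GMP).** Let $\mathcal G$ be a causal graph, i.e. an acyclic directed mixed graph: a finite vertex set $\mathbf V$ with directed edges $\to$ that form no directed cycle and bidirected edges $\leftrightarrow$ between distinct vertices, where both a directed and a bidirected edge may join the same two vertices. For $\mathbf A\subseteq\mathbf V$ let $\mathrm{Pa}(\mathbf A)$, $\mathrm{An}(\mathbf A)$, $\mathrm{De}(\mathbf A)$ be the sets of parents, ancestors and descendants of $\mathbf A$, each including $\mathbf A$ itself, and let $\mathrm{Sp}(\mathbf A)=\bigcup_{X\in\mathbf A}\{Y : Y\leftrightarrow X\}$; $\mathbf A$ is *ancestral* if $\mathbf A=\mathrm{An}(\mathbf A)$. Let $\prec$ be a strict total order on $\mathbf V$ that is consistent with $\mathcal G$, i.e. $X\prec Y$ implies $Y\notin\mathrm{An}(\{X\})$, and put $\mathbf V^{\le X}=\{Y : Y\prec X \text{ or } Y=X\}$. Let $P$ be a joint probability distribution of the variables $\mathbf V$, each taking values in a standard Borel space (for instance a finite set or $\mathbb R$); conditional independence $\mathbf A\perp\!\!\!\perp\mathbf B\mid\mathbf Z$ of sets of variables is meant with respect to $P$. A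 path is a sequence of distinct vertices together with a choice of an edge of $\mathcal G$ between each two consecutive ones. An inner vertex of a path is a *collider* on it if both path edges at this vertex have an arrowhead at it; all other vertices of the path are non-colliders. A set $\mathbf Z$ *blocks* a path if the path contains a collider $W$ with $\mathrm{De}(\{W\})\cap\mathbf Z=\emptyset$, or a non-collider in $\mathbf Z$. For pairwise disjoint $\mathbf A,\mathbf B,\mathbf Z\subseteq\mathbf V$, $\mathbf Z$ *d-separates* $\mathbf A$ from $\mathbf B$ if $\mathbf Z$ blocks every path from a vertex in $\mathbf A$ to a vertex in $\mathbf B$. For $X\in\mathbf V$, a set $\mathbf C$ is an *ancestral c-component relative to $X$* if there is an ancestral set $\mathbf S\subseteq\mathbf V^{\le X}$ with $X\in\mathbf S$ such that $\mathbf C$ is the c-component of $X$ in the induced subgraph $\mathcal G_{\mathbf S}$, i.e. the set of all vertices joined to $X$ by a (possibly trivial) path of bidirected edges in $\mathcal G_{\mathbf S}$. Then the following two properties of $P$ are equivalent. 1. (Global Markov property for $\mathcal G$.) For all pairwise disjoint $\mathbf A,\mathbf B,\mathbf Z\subseteq\mathbf V$ with $\mathbf A,\mathbf B\neq\emptyset$: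 if $\mathbf Z$ d-separates $\mathbf A$ from $\mathbf B$ in $\mathcal G$, then $\mathbf A\perp\!\!\!\perp\mathbf B\mid\mathbf Z$. 2. (C-component local Markov property for $\mathcal G$ with respect to $\prec$.) For every $X\in\mathbf V$ and every ancestral c-component $\mathbf C$ relative to $X$, $$X\perp\!\!\!\perp \mathbf S^+\setminus\mathrm{Pa}(\mathbf C)\ \big|\ \mathrm{Pa}(\mathbf C)\setminus\{X\},\qquad\text{where } \mathbf S^+=\mathbf V^{\le X}\setminus\mathrm{De}\big(\mathrm{Sp}(\mathbf C)\setminus\mathrm{Pa}(\mathbf C)\big).$$ -/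

import Mathlib

/-- A causal graph (acyclic directed mixed graph) on the variables `V`: directed edges without
directed cycles, and bidirected edges between distinct variables. A directed and a bidirected edge
between the same two variables may both be present. -/
structure CausalGraph (V : Type*) where
  /-- `dir x y` is the directed edge `x → y`. -/
  dir : V → V → Prop
  /-- `bi x y` is the bidirected edge `x ↔ y`. -/
  bi : V → V → Prop
  acyclic : ∀ x, ¬ Relation.TransGen dir x x
  bi_symm : ∀ x y, bi x y → bi y x
  bi_irrefl : ∀ x, ¬ bi x x

namespace CausalGraph

/-- The parents of a set of variables, including the set itself. -/
def parents {V : Type*} (G : CausalGraph V) (A : Set V) : Set V :=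
  A ∪ {y | ∃ x ∈ A, G.dir y x}

/-- The ancestors of a set of variables, including the set itself. -/
def ancestors {V : Type*} (G : CausalGraph V) (A : Set V) : Set V :=
  {y | ∃ x ∈ A, Relation.ReflTransGen G.dir y x}

/-- The descendants of a set of variables, including the set itself. -/
def descendants {V : Type*} (G : CausalGraph V) (A : Set V) : Set V :=
  {y | ∃ x ∈ A, Relation.ReflTransGen G.dir x y}

/-- The spouses of a set of variables. -/
def spouses {V : Type*} (G : CausalGraph V) (A : Set V) : Set V :=
  {y | ∃ x ∈ A, G.bi y x}

/-- A set of variables that contains its own ancestors. -/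
def IsAncestral {V : Type*} (G : CausalGraph V) (A : Set V) : Prop :=
  A = G.ancestors A

/-- The subgraph of `G` induced on a set of variables. -/
def induce {V : Type*} (G : CausalGraph V) (S : Set V) : CausalGraph S where
  dir x y := G.dir x y
  bi x y := G.bi x y
  acyclic x h := G.acyclic x (h.lift Subtype.val fun _ _ hab => hab)
  bi_symm x y h := G.bi_symm x y h
  bi_irrefl x := G.bi_irrefl x

/-- The c-component of `x`: all variables joined to `x` by a (possibly trivial) path of
bidirected edges. -/
def cComponent {V : Type*} (G : CausalGraph V) (x : V) : Set V :=
  {y | Relation.ReflTransGen G.bi x y}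

/-- The strict total order `prec` of the variables is consistent with `G`. -/
structure IsConsistentOrdering {V : Type*} (G : CausalGraph V) (prec : V → V → Prop) : Prop where
  isStrictTotalOrder : IsStrictTotalOrder V prec
  not_mem_ancestors : ∀ x y, prec x y → y ∉ G.ancestors {x}

/-- The variables that precede `x` in the order, together with `x`. -/
def upTo {V : Type*} (prec : V → V → Prop) (x : V) : Set V :=
  {y | prec y x ∨ y = x}

/-- `C` is an ancestral c-component relative to `x`: it is the c-component of `x` in the subgraph
induced on some ancestral set `S` of variables up to `x` that contains `x`. -/
def IsAncestralCComponent {V : Type*} (G : CausalGraph V) (prec : V → V → Prop) (x : V)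
    (C : Set V) : Prop :=
  ∃ (S : Set V) (hx : x ∈ S), S ⊆ upTo prec x ∧ G.IsAncestral S ∧
    Subtype.val '' (G.induce S).cComponent ⟨x, hx⟩ = C

/-- The ways in which an edge can be traversed from its first to its second end:
`x → y`, `x ← y`, `x ↔ y`. -/
inductive EdgeKind
  | forward
  | backward
  | bidirected

/-- The edge from `x` to `y` of the given kind is present in `G`. -/
def HasEdge {V : Type*} (G : CausalGraph V) : EdgeKind → V → V → Prop
  | .forward, x, y => G.dir x y
  | .backward, x, y => G.dir y x
  | .bidirected, x, y => G.bi x y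

/-- The edge has an arrowhead at its first end. -/
def EdgeKind.IntoFirst (e : EdgeKind) : Prop := e = .backward ∨ e = .bidirected

/-- The edge has an arrowhead at its second end. -/
def EdgeKind.IntoSecond (e : EdgeKind) : Prop := e = .forward ∨ e = .bidirected

/-- A path: distinct nodes `node 0, …, node length`, where `edge i` joins `node i` to
`node (i + 1)` for `i < length`. The values at larger indices are irrelevant. -/
structure Path {V : Type*} (G : CausalGraph V) where
  length : ℕ
  node : ℕ → V
  edge : ℕ → EdgeKind
  hasEdge : ∀ i < length, G.HasEdge (edge i) (node i) (node (i + 1))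
  node_injOn : Set.InjOn node (Set.Iic length)

/-- The `i`-th node of the path is a collider: it is an inner node, and both path edges at it
have an arrowhead at it. -/
def Path.IsCollider {V : Type*} {G : CausalGraph V} (p : G.Path) (i : ℕ) : Prop :=
  0 < i ∧ i < p.length ∧ (p.edge (i - 1)).IntoSecond ∧ (p.edge i).IntoFirst

/-- The path is blocked by `Z`: some node on it is a collider without descendants (itself
included) in `Z`, or is not a collider and lies in `Z`. -/
def Path.IsBlocked {V : Type*} {G : CausalGraph V} (p : G.Path) (Z : Set V) : Prop :=
  ∃ i ≤ p.length, (p.IsCollider i ∧ Disjoint (G.descendants {p.node i}) Z) ∨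
    (¬ p.IsCollider i ∧ p.node i ∈ Z)

/-- `Z` d-separates `A` from `B`: it blocks every path from a node in `A` to a node in `B`. -/
def DSeparated {V : Type*} (G : CausalGraph V) (A B Z : Set V) : Prop :=
  ∀ p : G.Path, p.node 0 ∈ A → p.node p.length ∈ B → p.IsBlocked Z

/-- Under the joint distribution `P` of the variables, the variables in `A` are conditionally
independent of those in `B` given those in `Z`. -/
def CondIndepVars {V : Type*} [Finite V] {α : V → Type*} [∀ v, MeasurableSpace (α v)]
    [∀ v, StandardBorelSpace (α v)] (P : MeasureTheory.Measure (∀ v, α v))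
    [MeasureTheory.IsProbabilityMeasure P] (A B Z : Set V) : Prop :=
  ProbabilityTheory.CondIndepFun
    (MeasurableSpace.comap (Z.domRestrict : (∀ v, α v) → ∀ v : Z, α v) inferInstance)
    (Set.measurable_restrict Z).comap_le
    (A.domRestrict : (∀ v, α v) → ∀ v : A, α v) (B.domRestrict : (∀ v, α v) → ∀ v : B, α v) P

/-- The global Markov property: every d-separation gives a conditional independence. -/
def GlobalMarkov {V : Type*} [Finite V] {α : V → Type*} [∀ v, MeasurableSpace (α v)]
    [∀ v, StandardBorelSpace (α v)] (G : CausalGraph V) (P : MeasureTheory.Measure (∀ v, α v))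
    [MeasureTheory.IsProbabilityMeasure P] : Prop :=
  ∀ A B Z : Set V, Disjoint A B → Disjoint A Z → Disjoint B Z → A.Nonempty → B.Nonempty →
    G.DSeparated A B Z → CondIndepVars P A B Z

/-- The set `S⁺` of the variables up to `x` that do not descend from a spouse of `C` outside
the parents of `C`. -/
def sPlus {V : Type*} (G : CausalGraph V) (prec : V → V → Prop) (x : V) (C : Set V) : Set V :=
  upTo prec x \ G.descendants (G.spouses C \ G.parents C)

/-- The c-component local Markov property with respect to the order `prec`. -/
def CComponentLocalMarkov {V : Type*} [Finite V] {α : V → Type*} [∀ v, MeasurableSpace (α v)]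
    [∀ v, StandardBorelSpace (α v)] (G : CausalGraph V) (prec : V → V → Prop)
    (P : MeasureTheory.Measure (∀ v, α v)) [MeasureTheory.IsProbabilityMeasure P] : Prop :=
  ∀ (x : V) (C : Set V), G.IsAncestralCComponent prec x C →
    CondIndepVars P {x} (G.sPlus prec x C \ G.parents C) (G.parents C \ {x})

end CausalGraph

/-! Global to local: `Pa(C) \ {X}` d-separates `X` from `S⁺ \ Pa(C)`. An unblocked path between them
stays in the ancestral set `S⁺`, where `X` has no child, and its nodes in `Pa(C)` other than `X`
must be colliders. So, starting at `X`, every edge is bidirected; a spouse of `C` in `S⁺` that the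
path visits lies in `Pa(C)`, hence in `C`. The path never leaves `C` (`dSeparated_sPlus`).

Local to global: work in `S = An(A ∪ B ∪ Z)` and call two vertices adjacent if a collider path in
`S` joins them (`AugAdj`). The graphical half: the vertices reached from `A` by open walks are
closed under adjacency away from `Z` and miss `B` (`Reach.of_augAdj`, `Walk.exists_path`), so `S \
Z` splits into two non-adjacent parts, one containing `A`, the other `B`. The probabilistic half:
such parts are independent given `Z`, by induction on `S`, removing its `≺`-last vertex
(`CComponentLocalMarkov.condIndepVars_of_not_augAdj`). Only symmetry, decomposition, weak union and
contraction are used, so `P` needs no positivity. -/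

open MeasureTheory ProbabilityTheory

/-! ### Conditional independence of σ-algebras -/

section CondIndep

variable {Ω : Type*} {m' m₁ m₂ mΩ : MeasurableSpace Ω} [StandardBorelSpace Ω]
  {μ : Measure Ω} [IsFiniteMeasure μ]

/-- Conditional independence given `m'` extends from `m₂` to `m' ⊔ m₂`. -/
theorem condIndep_sup_right (hm' : m' ≤ mΩ) (hm₁ : m₁ ≤ mΩ) (hm₂ : m₂ ≤ mΩ)
    (h : CondIndep m' m₁ m₂ hm' μ) : CondIndep m' m₁ (m' ⊔ m₂) hm' μ := by
  rw [condIndep_iff _ _ _ hm' hm₁ hm₂] at h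
  -- The events `z ∩ s` form a π-system generating `m' ⊔ m₂`, so the product formula need only be
  -- checked on them.
  set p : Set (Set Ω) := Set.image2 (· ∩ ·) {z | MeasurableSet[m'] z} {s | MeasurableSet[m₂] s}
  have hpi : IsPiSystem p := by
    rintro _ ⟨z, hz, s, hs, rfl⟩ _ ⟨z', hz', s', hs', rfl⟩ -
    exact ⟨z ∩ z', MeasurableSet.inter hz hz', s ∩ s', MeasurableSet.inter hs hs',
      Set.inter_inter_inter_comm z z' s s'⟩
  have hgen : m' ⊔ m₂ = MeasurableSpace.generateFrom p := by
    refine le_antisymm (sup_le (fun z hz => ?_) (fun s hs => ?_))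
      (MeasurableSpace.generateFrom_le ?_)
    · exact MeasurableSpace.measurableSet_generateFrom
        ⟨z, hz, Set.univ, MeasurableSet.univ, Set.inter_univ z⟩
    · exact MeasurableSpace.measurableSet_generateFrom
        ⟨Set.univ, MeasurableSet.univ, s, hs, Set.univ_inter s⟩
    · rintro _ ⟨z, hz, s, hs, rfl⟩
      exact MeasurableSet.inter (le_sup_left (a := m') (b := m₂) z hz)
        (le_sup_right (a := m') (b := m₂) s hs)
  refine CondIndepSets.condIndep (p1 := {t | MeasurableSet[m₁] t}) (p2 := p) hm₁ (sup_le hm' hm₂)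
    (@MeasurableSpace.isPiSystem_measurableSet _ m₁) hpi
    (@MeasurableSpace.generateFrom_measurableSet _ m₁).symm hgen ?_
  rw [condIndepSets_iff _ hm' {t | MeasurableSet[m₁] t} p (fun t ht => hm₁ t ht)
    (by rintro _ ⟨z, hz, s, hs, rfl⟩; exact (hm' z hz).inter (hm₂ s hs))]
  rintro t _ ht ⟨z, hz, s, hs, rfl⟩
  have key : ∀ u, MeasurableSet u → μ⟦z ∩ u | m'⟧ =ᵐ[μ] z.indicator (μ⟦u | m'⟧) := by
    intro u hu
    have := condExp_indicator (m := m') (μ := μ) (s := z)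
      (((integrable_const (1 : ℝ)).indicator hu : Integrable (u.indicator fun _ => (1 : ℝ)) μ)) hz
    rwa [Set.indicator_indicator] at this
  have h₁ := key (t ∩ s) ((hm₁ t ht).inter (hm₂ s hs))
  rw [Set.inter_left_comm] at h₁
  filter_upwards [h₁, key s (hm₂ s hs), h t s ht hs] with ω e₁ e₂ e₃
  simp only [Pi.mul_apply] at e₃ ⊢
  rw [e₁, e₂]
  by_cases hω : ω ∈ z
  · simp [hω, e₃]
  · simp [hω]

/-- Two σ-algebras are conditionally independent given a third one if and only if additionally
conditioning on the second one does not change the conditional probabilities of the events in the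
first one. -/
theorem condIndep_iff_condExp_sup_ae_eq (hm' : m' ≤ mΩ) (hm₁ : m₁ ≤ mΩ) (hm₂ : m₂ ≤ mΩ) :
    CondIndep m' m₁ m₂ hm' μ ↔
      ∀ t, MeasurableSet[m₁] t → μ⟦t | m' ⊔ m₂⟧ =ᵐ[μ] μ⟦t | m'⟧ := by
  have hle : m' ⊔ m₂ ≤ mΩ := sup_le hm' hm₂
  have hint : ∀ u, MeasurableSet u → Integrable (u.indicator fun _ => (1 : ℝ)) μ :=
    fun u hu => (integrable_const (1 : ℝ)).indicator hu
  have pull : ∀ t u, MeasurableSet t → MeasurableSet u →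
      μ[u.indicator (μ⟦t | m'⟧) | m'] =ᵐ[μ] μ⟦t | m'⟧ * μ⟦u | m'⟧ := by
    intro t u ht hu
    have e : u.indicator (μ⟦t | m'⟧) = (μ⟦t | m'⟧) * u.indicator fun _ => (1 : ℝ) := by
      ext ω; by_cases hω : ω ∈ u <;> simp [hω]
    rw [e]
    refine condExp_mul_of_stronglyMeasurable_left stronglyMeasurable_condExp ?_ (hint u hu)
    rw [← e]
    exact integrable_condExp.indicator hu
  constructor
  · intro h t ht
    have hm : StronglyMeasurable[m' ⊔ m₂] (μ⟦t | m'⟧) :=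
      stronglyMeasurable_condExp.mono le_sup_left
    -- The set-integral characterisation of `μ⟦t | m' ⊔ m₂⟧` tests against every `u` in `m' ⊔ m₂`;
    -- this is why independence is first enlarged from `m₂`.
    have h' := (condIndep_iff _ _ _ hm' hm₁ hle μ).1 (condIndep_sup_right hm' hm₁ hm₂ h)
    refine (ae_eq_condExp_of_forall_setIntegral_eq hle (hint t (hm₁ t ht))
      (fun _ _ _ => integrable_condExp.integrableOn) (fun u hu _ => ?_)
      hm.aestronglyMeasurable).symm
    have hu' := hle u hu
    rw [← integral_indicator hu', ← integral_condExp hm', ← integral_indicator hu',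
      ← integral_condExp (f := u.indicator _) hm']
    refine integral_congr_ae ((pull t u (hm₁ t ht) hu').trans ?_)
    rw [Set.indicator_indicator, Set.inter_comm]
    exact (h' t u ht hu).symm
  · intro h
    rw [condIndep_iff _ _ _ hm' hm₁ hm₂]
    intro t s ht hs
    have ht' := hm₁ t ht
    have hs' := hm₂ s hs
    refine Filter.EventuallyEq.trans ?_ (pull t s ht' hs')
    refine (condExp_condExp_of_le (le_sup_left (a := m') (b := m₂)) hle).symm.trans ?_
    refine condExp_congr_ae ?_
    have e : ((t ∩ s).indicator fun _ => (1 : ℝ)) = s.indicator (t.indicator fun _ => (1 : ℝ)) := by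
      rw [Set.indicator_indicator, Set.inter_comm]
    rw [e]
    refine (condExp_indicator (hint t ht') (le_sup_right (a := m') (b := m₂) s hs)).trans ?_
    filter_upwards [h t ht] with ω hω
    by_cases hωs : ω ∈ s <;> simp [hωs, hω]

end CondIndep

namespace CausalGraph

/-! ### Semi-graphoid rules for sets of variables -/

section CondIndepVars

variable {V : Type*} {α : V → Type*} [∀ v, MeasurableSpace (α v)]

/-- The σ-algebra generated by the variables in a set. -/
abbrev varsAlgebra (α : V → Type*) [∀ v, MeasurableSpace (α v)] (A : Set V) :
    MeasurableSpace (∀ v, α v) :=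
  MeasurableSpace.comap (A.domRestrict : (∀ v, α v) → ∀ v : A, α v) inferInstance

theorem varsAlgebra_le (A : Set V) : varsAlgebra α A ≤ MeasurableSpace.pi :=
  (Set.measurable_restrict A).comap_le

theorem varsAlgebra_eq_iSup (A : Set V) :
    varsAlgebra α A = ⨆ v ∈ A, MeasurableSpace.comap (fun ω : ∀ v, α v => ω v) inferInstance := by
  rw [iSup_subtype']
  simp only [varsAlgebra, MeasurableSpace.pi, MeasurableSpace.comap_iSup,
    MeasurableSpace.comap_comp]
  rfl

theorem varsAlgebra_union (A B : Set V) :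
    varsAlgebra α (A ∪ B) = varsAlgebra α A ⊔ varsAlgebra α B := by
  simp only [varsAlgebra_eq_iSup, iSup_union]

theorem varsAlgebra_mono {A B : Set V} (h : A ⊆ B) : varsAlgebra α A ≤ varsAlgebra α B := by
  rw [← Set.union_eq_self_of_subset_left h, varsAlgebra_union]
  exact le_sup_left

theorem varsAlgebra_empty : varsAlgebra α (∅ : Set V) = ⊥ := by
  simp [varsAlgebra_eq_iSup]

variable [Finite V] [∀ v, StandardBorelSpace (α v)] {P : Measure (∀ v, α v)}
  [IsProbabilityMeasure P] {A B W Z : Set V}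

theorem condIndepVars_iff_condIndep : CondIndepVars P A B Z ↔
    CondIndep (varsAlgebra α Z) (varsAlgebra α A) (varsAlgebra α B) (varsAlgebra_le Z) P :=
  condIndepFun_iff_condIndep ..

/-- In this form weak union and contraction become statements about nested conditioning. -/
theorem condIndepVars_iff_condExp : CondIndepVars P A B Z ↔
    ∀ t, MeasurableSet[varsAlgebra α A] t →
      P⟦t | varsAlgebra α (Z ∪ B)⟧ =ᵐ[P] P⟦t | varsAlgebra α Z⟧ := by
  rw [condIndepVars_iff_condIndep, varsAlgebra_union,
    condIndep_iff_condExp_sup_ae_eq _ (varsAlgebra_le A) (varsAlgebra_le B)]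

theorem CondIndepVars.symm (h : CondIndepVars P A B Z) : CondIndepVars P B A Z :=
  condIndepVars_iff_condIndep.2 (condIndepVars_iff_condIndep.1 h).symm

theorem CondIndepVars.mono {A' B' : Set V} (h : CondIndepVars P A B Z) (hA : A' ⊆ A)
    (hB : B' ⊆ B) : CondIndepVars P A' B' Z :=
  condIndepVars_iff_condIndep.2 <| condIndep_of_condIndep_of_le_left
    (condIndep_of_condIndep_of_le_right (condIndepVars_iff_condIndep.1 h) (varsAlgebra_mono hB))
    (varsAlgebra_mono hA)

theorem condIndepVars_empty_right (P : Measure (∀ v, α v)) [IsProbabilityMeasure P]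
    (A Z : Set V) : CondIndepVars P A ∅ Z := by
  rw [condIndepVars_iff_condIndep, varsAlgebra_empty]
  exact condIndep_bot_right _

theorem condIndepVars_empty_left (P : Measure (∀ v, α v)) [IsProbabilityMeasure P]
    (B Z : Set V) : CondIndepVars P ∅ B Z :=
  (condIndepVars_empty_right P B Z).symm

/-- The conditional probability given `Z ∪ B` already equals a `Z`-measurable function, so by the
tower property conditioning on the intermediate `Z ∪ W` gives the same function. -/
theorem CondIndepVars.weak_union (h : CondIndepVars P A B Z) (hW : W ⊆ B) :
    CondIndepVars P A B (Z ∪ W) := by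
  rw [condIndepVars_iff_condExp] at h ⊢
  intro t ht
  rw [Set.union_assoc, Set.union_eq_self_of_subset_left hW]
  refine (h t ht).trans ?_
  have hle : varsAlgebra α (Z ∪ W) ≤ varsAlgebra α (Z ∪ B) :=
    varsAlgebra_mono (Set.union_subset_union_right Z hW)
  have e := (condExp_condExp_of_le (f := t.indicator fun _ => (1 : ℝ)) (μ := P) hle
    (varsAlgebra_le _)).symm.trans (condExp_congr_ae (h t ht))
  rw [condExp_of_stronglyMeasurable (varsAlgebra_le (Z ∪ W))
    (stronglyMeasurable_condExp.mono (varsAlgebra_mono Set.subset_union_left))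
    integrable_condExp] at e
  exact e.symm

theorem CondIndepVars.contraction (h : CondIndepVars P A B (Z ∪ W)) (h' : CondIndepVars P A W Z) :
    CondIndepVars P A (B ∪ W) Z := by
  rw [condIndepVars_iff_condExp] at h h' ⊢
  intro t ht
  rw [Set.union_comm B W, ← Set.union_assoc]
  exact (h t ht).trans (h' t ht)

end CondIndepVars

end CausalGraph

namespace CausalGraph

variable {V : Type*} {G : CausalGraph V}

/-! ### Ancestral sets, components and consistent orders -/

section Basic

theorem isAncestral_iff {S : Set V} : G.IsAncestral S ↔ ∀ x y, G.dir x y → y ∈ S → x ∈ S := by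
  constructor
  · intro h x y hxy hy
    rw [h]
    exact ⟨y, hy, .single hxy⟩
  · intro h
    refine Set.Subset.antisymm (fun x hx => ⟨x, hx, .refl⟩) ?_
    rintro x ⟨y, hy, hxy⟩
    induction hxy using Relation.ReflTransGen.head_induction_on with
    | refl => exact hy
    | head hab _ ih => exact h _ _ hab ih

theorem IsAncestral.mem_of_reflTransGen {S : Set V} (hS : G.IsAncestral S) {x y : V}
    (h : Relation.ReflTransGen G.dir x y) (hy : y ∈ S) : x ∈ S := by
  rw [hS]
  exact ⟨y, hy, h⟩

theorem IsAncestral.parents_subset {S C : Set V} (hS : G.IsAncestral S) (hC : C ⊆ S) :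
    G.parents C ⊆ S := by
  rintro y (hy | ⟨x, hx, hyx⟩)
  · exact hC hy
  · exact isAncestral_iff.1 hS y x hyx (hC hx)

theorem isAncestral_ancestors (A : Set V) : G.IsAncestral (G.ancestors A) :=
  isAncestral_iff.2 fun _ _ hxy ⟨z, hz, hyz⟩ => ⟨z, hz, .head hxy hyz⟩

theorem subset_ancestors (A : Set V) : A ⊆ G.ancestors A := fun x hx => ⟨x, hx, .refl⟩

/-- A bidirected edge inside `S`. -/
def BiStep (G : CausalGraph V) (S : Set V) (x y : V) : Prop := x ∈ S ∧ y ∈ S ∧ G.bi x y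

/-- The vertices joined to `x` by a path of bidirected edges inside `S`. -/
def component (G : CausalGraph V) (S : Set V) (x : V) : Set V :=
  {y | Relation.ReflTransGen (G.BiStep S) x y}

theorem mem_component_self (S : Set V) (x : V) : x ∈ G.component S x := Relation.ReflTransGen.refl

theorem component_subset {S : Set V} {x : V} (hx : x ∈ S) : G.component S x ⊆ S := by
  intro y hy
  induction hy with
  | refl => exact hx
  | tail _ h _ => exact h.2.1

theorem BiStep.symm {S : Set V} {x y : V} (h : G.BiStep S x y) : G.BiStep S y x :=
  ⟨h.2.1, h.1, G.bi_symm _ _ h.2.2⟩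

theorem image_cComponent_induce {S : Set V} {x : V} (hx : x ∈ S) :
    Subtype.val '' (G.induce S).cComponent ⟨x, hx⟩ = G.component S x := by
  refine Set.Subset.antisymm ?_ fun y hy => ?_
  · rintro _ ⟨y, hy, rfl⟩
    exact Relation.ReflTransGen.lift (p := G.BiStep S) Subtype.val
      (fun a b (hab : (G.induce S).bi a b) => ⟨a.2, b.2, hab⟩) _ _ hy
  · induction hy with
    | refl => exact ⟨⟨x, hx⟩, Relation.ReflTransGen.refl, rfl⟩
    | tail _ h ih =>
      obtain ⟨b, hb, rfl⟩ := ih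
      exact ⟨⟨_, h.2.1⟩, Relation.ReflTransGen.tail hb h.2.2, rfl⟩

variable {prec : V → V → Prop}

theorem IsConsistentOrdering.prec_of_dir (h : G.IsConsistentOrdering prec) {x y : V}
    (hxy : G.dir x y) : prec x y := by
  have := h.isStrictTotalOrder
  rcases trichotomous_of prec x y with h1 | h1 | h1
  · exact h1
  · subst h1
    exact absurd (.single hxy) (G.acyclic x)
  · exact absurd ⟨y, rfl, .single hxy⟩ (h.not_mem_ancestors y x h1)

theorem IsConsistentOrdering.not_dir_of_mem_upTo (h : G.IsConsistentOrdering prec) {x y : V}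
    (hy : y ∈ upTo prec x) : ¬ G.dir x y := by
  have := h.isStrictTotalOrder
  intro hxy
  have h1 := h.prec_of_dir hxy
  rcases hy with h2 | rfl
  · exact asymm_of prec h1 h2
  · exact irrefl_of prec y h1

theorem IsConsistentOrdering.isAncestral_upTo (h : G.IsConsistentOrdering prec) (x : V) :
    G.IsAncestral (upTo prec x) := by
  have := h.isStrictTotalOrder
  refine isAncestral_iff.2 fun y z hyz hz => Or.inl ?_
  rcases hz with hz | rfl
  · exact trans_of prec (h.prec_of_dir hyz) hz
  · exact h.prec_of_dir hyz

theorem IsConsistentOrdering.isAncestral_sPlus (h : G.IsConsistentOrdering prec) (x : V)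
    (C : Set V) : G.IsAncestral (G.sPlus prec x C) :=
  isAncestral_iff.2 fun y z hyz hz => ⟨isAncestral_iff.1 (h.isAncestral_upTo x) y z hyz hz.1,
    fun ⟨w, hw, hwy⟩ => hz.2 ⟨w, hw, .tail hwy hyz⟩⟩

/-- If a vertex of `S` descended from a spouse of `C`, that spouse would lie in `S` by ancestrality,
hence in the component `C` itself. -/
theorem IsAncestral.subset_sPlus {S : Set V} (hS : G.IsAncestral S) {x : V} (hx : x ∈ S)
    (hSx : S ⊆ upTo prec x) : S ⊆ G.sPlus prec x (G.component S x) := by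
  rintro y hy
  refine ⟨hSx hy, ?_⟩
  rintro ⟨w, ⟨⟨c, hc, hwc⟩, hw⟩, hwy⟩
  have hwS := hS.mem_of_reflTransGen hwy hy
  exact hw (Or.inl (Relation.ReflTransGen.tail hc
    ⟨component_subset hx hc, hwS, G.bi_symm _ _ hwc⟩))

end Basic

/-! ### From the global to the local property -/

section GlobalToLocal

/-- A collider has a descendant in `Z`. Any other inner node emits a path edge; following directed
edges that way leads to a collider or an end of the path. So every node is an ancestor of `T`. -/
theorem Path.node_mem_of_not_isBlocked {p : G.Path} {Z T : Set V} (hp : ¬ p.IsBlocked Z)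
    (hT : G.IsAncestral T) (hZ : Z ⊆ T) (h₀ : p.node 0 ∈ T) (h₁ : p.node p.length ∈ T)
    {i : ℕ} (hi : i ≤ p.length) : p.node i ∈ T := by
  have hcol : ∀ i ≤ p.length, p.IsCollider i → p.node i ∈ T := by
    intro i hi hc
    by_contra hiT
    refine hp ⟨i, hi, Or.inl ⟨hc, Set.disjoint_left.2 ?_⟩⟩
    rintro z ⟨_, rfl, hz⟩ hzZ
    exact hiT (hT.mem_of_reflTransGen hz (hZ hzZ))
  have hstep := isAncestral_iff.1 hT
  -- Here `k` counts the edges remaining after edge `i`, so the induction runs backwards from the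
  -- end of the path; `hbwd` is the mirror image, running from node `0`.
  have hfwd : ∀ k i, i + 1 + k = p.length → p.edge i = .forward → p.node i ∈ T := by
    intro k
    induction k with
    | zero =>
      intro i hi he
      have := p.hasEdge i (by omega)
      rw [he] at this
      refine hstep _ _ this ?_
      rwa [show i + 1 = p.length by omega]
    | succ k ih =>
      intro i hi he
      have := p.hasEdge i (by omega)
      rw [he] at this
      refine hstep _ _ this ?_
      by_cases he' : (p.edge (i + 1)).IntoFirst
      · exact hcol _ (by omega) ⟨by omega, by omega, Or.inl (by simpa using he), he'⟩
      · refine ih (i + 1) (by omega) ?_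
        cases h : p.edge (i + 1) <;> simp_all [EdgeKind.IntoFirst]
  have hbwd : ∀ i < p.length, p.edge i = .backward → p.node (i + 1) ∈ T := by
    intro i
    induction i with
    | zero =>
      intro hi he
      have := p.hasEdge 0 hi
      rw [he] at this
      exact hstep _ _ this h₀
    | succ i ih =>
      intro hi he
      have := p.hasEdge (i + 1) hi
      rw [he] at this
      refine hstep _ _ this ?_
      by_cases he' : (p.edge i).IntoSecond
      · exact hcol _ (by omega) ⟨by omega, by omega, by simpa using he', Or.inl he⟩
      · refine ih (by omega) ?_
        cases h : p.edge i <;> simp_all [EdgeKind.IntoSecond]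
  rcases Nat.eq_zero_or_pos i with rfl | h0
  · exact h₀
  rcases hi.eq_or_lt with rfl | hlt
  · exact h₁
  by_cases hc : p.IsCollider i
  · exact hcol i hi hc
  have hc' : ¬ (p.edge (i - 1)).IntoSecond ∨ ¬ (p.edge i).IntoFirst := by
    by_contra h
    push Not at h
    exact hc ⟨h0, hlt, h.1, h.2⟩
  rcases hc' with hc' | hc'
  · have := hbwd (i - 1) (by omega)
      (by cases h : p.edge (i - 1) <;> simp_all [EdgeKind.IntoSecond])
    rwa [show i - 1 + 1 = i by omega] at this
  · exact hfwd (p.length - (i + 1)) i (by omega)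
      (by cases h : p.edge i <;> simp_all [EdgeKind.IntoFirst])

theorem dSeparated_sPlus {prec : V → V → Prop} (hprec : G.IsConsistentOrdering prec) {x : V}
    {S : Set V} (hx : x ∈ S) (hSx : S ⊆ upTo prec x) (hS : G.IsAncestral S) :
    G.DSeparated {x} (G.sPlus prec x (G.component S x) \ G.parents (G.component S x))
      (G.parents (G.component S x) \ {x}) := by
  intro p h₀ h₁
  by_contra hp
  set C := G.component S x
  have hCS : C ⊆ S := component_subset hx
  have hPS : G.parents C ⊆ S := hS.parents_subset hCS
  have hSp : S ⊆ G.sPlus prec x C := hS.subset_sPlus hx hSx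
  have h₀' : p.node 0 = x := h₀
  have hmem : ∀ i ≤ p.length, p.node i ∈ G.sPlus prec x C := fun i hi =>
    p.node_mem_of_not_isBlocked hp (hprec.isAncestral_sPlus x C)
      (fun z hz => hSp (hPS hz.1)) (by rw [h₀']; exact hSp hx) h₁.1 hi
  have hne : ∀ i ≤ p.length, 0 < i → p.node i ≠ x := by
    intro i hi hi0 h
    have := p.node_injOn (Set.mem_Iic.2 hi) (Set.mem_Iic.2 (Nat.zero_le _)) (h.trans h₀'.symm)
    omega
  have hcol : ∀ i ≤ p.length, 0 < i → p.node i ∈ G.parents C → p.IsCollider i := by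
    intro i hi hi0 h
    by_contra hc
    exact hp ⟨i, hi, Or.inr ⟨hc, h, hne i hi hi0⟩⟩
  -- A forward edge would start at a non-collider of `C` or give `x` a child, and a backward edge
  -- would end at a non-collider of `Pa(C)`; only bidirected edges remain.
  have hC : ∀ i ≤ p.length, p.node i ∈ C := by
    intro i
    induction i with
    | zero =>
      intro _
      rw [h₀']
      exact mem_component_self S x
    | succ i ih =>
      intro hi
      have hiC := ih (by omega)
      have hedge := p.hasEdge i (by omega)
      cases he : p.edge i with
      | forward =>
        rw [he] at hedge
        exfalso
        rcases Nat.eq_zero_or_pos i with rfl | h0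
        · exact hprec.not_dir_of_mem_upTo (hmem 1 hi).1 (h₀' ▸ hedge)
        · have := (hcol i (by omega) h0 (Or.inl hiC)).2.2.2
          simp [he, EdgeKind.IntoFirst] at this
      | backward =>
        rw [he] at hedge
        have := (hcol (i + 1) hi (by omega) (Or.inr ⟨_, hiC, hedge⟩)).2.2.1
        simp [he, EdgeKind.IntoSecond] at this
      | bidirected =>
        rw [he] at hedge
        have hP : p.node (i + 1) ∈ G.parents C := by
          by_contra hP
          exact (hmem (i + 1) hi).2
            ⟨_, ⟨⟨_, hiC, G.bi_symm _ _ hedge⟩, hP⟩, .refl⟩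
        exact Relation.ReflTransGen.tail hiC ⟨hCS hiC, hPS hP, hedge⟩
  exact h₁.2 (Or.inl (hC p.length le_rfl))

theorem GlobalMarkov.cComponentLocalMarkov [Finite V] {α : V → Type*}
    [∀ v, MeasurableSpace (α v)] [∀ v, StandardBorelSpace (α v)] {prec : V → V → Prop}
    (hprec : G.IsConsistentOrdering prec) {P : Measure (∀ v, α v)} [IsProbabilityMeasure P]
    (h : G.GlobalMarkov P) : G.CComponentLocalMarkov prec P := by
  rintro x _ ⟨S, hx, hSx, hS, rfl⟩
  rw [image_cComponent_induce]
  rcases (G.sPlus prec x (G.component S x) \ G.parents (G.component S x)).eq_empty_or_nonempty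
    with he | hne
  · rw [he]
    exact condIndepVars_empty_right P _ _
  · refine h _ _ _ ?_ ?_ ?_ (Set.singleton_nonempty x) hne (dSeparated_sPlus hprec hx hSx hS)
    · exact Set.disjoint_singleton_left.2 fun hx' => hx'.2 (Or.inl (mem_component_self S x))
    · exact Set.disjoint_singleton_left.2 fun hx' => hx'.2 rfl
    · exact Set.disjoint_left.2 fun y hy hy' => hy.2 hy'.1

end GlobalToLocal

end CausalGraph

namespace CausalGraph

variable {V : Type*} {G : CausalGraph V}

/-! ### The augmented graph and its Markov property -/

section Augmented

/-- Adjacency in the augmented graph of the subgraph induced on `S`: the two vertices are joined by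
a path in `S` whose inner vertices are all colliders. -/
def AugAdj (G : CausalGraph V) (S : Set V) (a b : V) : Prop :=
  ∃ c d, c ∈ S ∧ Relation.ReflTransGen (G.BiStep S) c d ∧
    a ∈ G.parents {c} ∧ b ∈ G.parents {d}

theorem AugAdj.mono {S T : Set V} (hST : S ⊆ T) {a b : V} (h : G.AugAdj S a b) :
    G.AugAdj T a b := by
  obtain ⟨c, d, hc, hcd, ha, hb⟩ := h
  exact ⟨c, d, hST hc, Relation.ReflTransGen.mono (fun _ _ h => ⟨hST h.1, hST h.2.1, h.2.2⟩) _ _ hcd, ha, hb⟩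

theorem reflTransGen_biStep_symm {S : Set V} {x y : V}
    (h : Relation.ReflTransGen (G.BiStep S) x y) : Relation.ReflTransGen (G.BiStep S) y x := by
  induction h with
  | refl => exact .refl
  | tail _ hbc ih => exact .head hbc.symm ih

theorem AugAdj.symm {S : Set V} {a b : V} (h : G.AugAdj S a b) : G.AugAdj S b a := by
  obtain ⟨c, d, hc, hcd, ha, hb⟩ := h
  exact ⟨d, c, component_subset hc hcd,
    reflTransGen_biStep_symm hcd, hb, ha⟩

theorem mem_parents_iff {A : Set V} {y : V} : y ∈ G.parents A ↔ ∃ x ∈ A, y ∈ G.parents {x} := by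
  simp only [parents, Set.mem_union, Set.mem_ofPred_eq, Set.mem_singleton_iff, exists_eq_left]
  constructor
  · rintro (h | ⟨x, hx, h⟩)
    exacts [⟨y, h, Or.inl rfl⟩, ⟨x, hx, Or.inr h⟩]
  · rintro ⟨x, hx, rfl | h⟩
    exacts [Or.inl hx, Or.inr ⟨x, hx, h⟩]

/-- Bidirected paths to `x` and from `x` concatenate, so `Pa(C)` is a clique of the augmented graph.
-/
theorem augAdj_of_mem_parents_component {S : Set V} {x a b : V} (hx : x ∈ S)
    (ha : a ∈ G.parents (G.component S x)) (hb : b ∈ G.parents (G.component S x)) :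
    G.AugAdj S a b := by
  obtain ⟨c, hc, hac⟩ := mem_parents_iff.1 ha
  obtain ⟨d, hd, hbd⟩ := mem_parents_iff.1 hb
  exact ⟨c, d, component_subset hx hc,
    (reflTransGen_biStep_symm hc).trans hd, hac, hbd⟩

variable [Finite V] {α : V → Type*} [∀ v, MeasurableSpace (α v)]
  [∀ v, StandardBorelSpace (α v)] {prec : V → V → Prop} {P : Measure (∀ v, α v)}
  [IsProbabilityMeasure P]

/-- The local property for `C` restricts from `S⁺` to `S`; weak union then moves everything outside
`Pa(C) ∪ B` into the conditioning set. -/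
theorem CComponentLocalMarkov.condIndepVars_of_disjoint (h : G.CComponentLocalMarkov prec P)
    {S : Set V} (hS : G.IsAncestral S) {x : V} (hx : x ∈ S) (hSx : S ⊆ upTo prec x)
    {B W : Set V} (hBS : B ⊆ S) (hB : Disjoint (G.parents (G.component S x)) B)
    (hW : S \ {x} = B ∪ W) : CondIndepVars P {x} B W := by
  set C := G.component S x
  have hPS : G.parents C ⊆ S := hS.parents_subset (component_subset hx)
  have h₀ := h x C ⟨S, hx, hSx, hS, image_cComponent_induce hx⟩
  have h₁ : CondIndepVars P {x} (S \ G.parents C) (G.parents C \ {x}) :=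
    h₀.mono le_rfl fun y hy => ⟨hS.subset_sPlus hx hSx hy.1, hy.2⟩
  have hBP : B ⊆ S \ G.parents C := fun y hy => ⟨hBS hy, Set.disjoint_right.1 hB hy⟩
  have hWS : W ⊆ S \ {x} := hW ▸ Set.subset_union_right
  have h₂ := h₁.weak_union (W := W \ G.parents C) fun y hy => ⟨(hWS hy.1).1, hy.2⟩
  have e : G.parents C \ {x} ∪ W \ G.parents C = W := by
    ext y
    constructor
    · rintro (hy | hy)
      · have : y ∈ B ∪ W := hW ▸ ⟨hPS hy.1, hy.2⟩
        exact this.resolve_left fun hyB => Set.disjoint_left.1 hB hy.1 hyB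
      · exact hy.1
    · intro hy
      by_cases hyP : y ∈ G.parents C
      · exact Or.inl ⟨hyP, (hWS hy).2⟩
      · exact Or.inr ⟨hy, hyP⟩
  rw [e] at h₂
  exact h₂.mono le_rfl hBP

theorem CComponentLocalMarkov.condIndepVars_of_not_augAdj (hprec : G.IsConsistentOrdering prec)
    (h : G.CComponentLocalMarkov prec P) (S : Set V) (hS : G.IsAncestral S) (A B Z : Set V)
    (hABZ : A ∪ B ∪ Z = S) (hAB : Disjoint A B) (hAZ : Disjoint A Z) (hBZ : Disjoint B Z)
    (hadj : ∀ a ∈ A, ∀ b ∈ B, ¬ G.AugAdj S a b) : CondIndepVars P A B Z := by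
  induction S using WellFoundedLT.induction generalizing A B Z with
  | ind S ih =>
  rcases S.eq_empty_or_nonempty with rfl | hne
  · rw [(Set.union_empty_iff.1 (Set.union_empty_iff.1 hABZ).1).1]
    exact condIndepVars_empty_left P _ _
  have := hprec.isStrictTotalOrder
  have : IsTrans V (flip prec) := ⟨fun _ _ _ h₁ h₂ => trans_of prec h₂ h₁⟩
  have : Std.Irrefl (flip prec) := ⟨fun y => irrefl_of prec y⟩
  -- A `≺`-last vertex of `S` has no child in `S`, so `S \ {x}` is again ancestral.
  obtain ⟨x, hx, hmax⟩ := (Finite.wellFounded_of_trans_of_irrefl (flip prec)).has_min S hne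
  have hSx : S ⊆ upTo prec x := by
    intro y hy
    rcases trichotomous_of prec y x with h1 | h1 | h1
    · exact Or.inl h1
    · exact Or.inr h1
    · exact absurd h1 (hmax y hy)
  have hS' : G.IsAncestral (S \ {x}) := by
    refine isAncestral_iff.2 fun y z hyz hz => ⟨isAncestral_iff.1 hS y z hyz hz.1, ?_⟩
    rintro rfl
    exact hprec.not_dir_of_mem_upTo (hSx hz.1) hyz
  have hlt : S \ {x} < S := Set.sdiff_singleton_ssubset.2 hx
  have hxP : x ∈ G.parents (G.component S x) := Or.inl (mem_component_self S x)
  have left : ∀ A B : Set V, A ∪ B ∪ Z = S → Disjoint A B → Disjoint A Z → Disjoint B Z →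
      (∀ a ∈ A, ∀ b ∈ B, ¬ G.AugAdj S a b) → x ∈ A → CondIndepVars P A B Z := by
    intro A B hABZ hAB hAZ hBZ hadj hxA
    have hxB := Set.disjoint_left.1 hAB hxA
    have hxZ := Set.disjoint_left.1 hAZ hxA
    have e : S \ {x} = A \ {x} ∪ B ∪ Z := by
      rw [← hABZ, Set.union_sdiff_distrib, Set.union_sdiff_distrib,
        Set.sdiff_singleton_eq_self hxB, Set.sdiff_singleton_eq_self hxZ]
    -- All of `Pa(C)` is adjacent to `x ∈ A`, so it misses `B`. Contraction with the induction
    -- hypothesis then puts `x` back into `A`.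
    have h₁ : CondIndepVars P {x} B (Z ∪ A \ {x}) := by
      refine h.condIndepVars_of_disjoint hS hx hSx ?_ ?_ ?_
      · rw [← hABZ]; exact fun y hy => Or.inl (Or.inr hy)
      · exact Set.disjoint_left.2 fun b hb hbB =>
          hadj x hxA b hbB (augAdj_of_mem_parents_component hx hxP hb)
      · rw [e, Set.union_comm (A \ {x}) B, Set.union_assoc, Set.union_comm Z]
    have h₂ : CondIndepVars P (A \ {x}) B Z :=
      ih _ hlt hS' _ _ _ e.symm (hAB.mono_left Set.sdiff_subset)
        (hAZ.mono_left Set.sdiff_subset) hBZ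
        fun a ha b hb hab => hadj a ha.1 b hb (hab.mono Set.sdiff_subset)
    refine (h₁.symm.contraction h₂.symm).symm.mono ?_ le_rfl
    intro y hy
    by_cases hyx : y = x
    · exact Or.inl hyx
    · exact Or.inr ⟨hy, hyx⟩
  have middle : ∀ A B : Set V, A ∪ B ∪ Z = S → Disjoint A B → Disjoint A Z → Disjoint B Z →
      (∀ a ∈ A, ∀ b ∈ B, ¬ G.AugAdj S a b) → x ∈ Z →
      Disjoint (G.parents (G.component S x)) B → CondIndepVars P A B Z := by
    intro A B hABZ hAB hAZ hBZ hadj hxZ hPB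
    have hxA := Set.disjoint_right.1 hAZ hxZ
    have hxB := Set.disjoint_right.1 hBZ hxZ
    have e : S \ {x} = A ∪ B ∪ Z \ {x} := by
      rw [← hABZ, Set.union_sdiff_distrib, Set.union_sdiff_distrib,
        Set.sdiff_singleton_eq_self hxA, Set.sdiff_singleton_eq_self hxB]
    have h₁ : CondIndepVars P {x} B (Z \ {x} ∪ A) := by
      refine h.condIndepVars_of_disjoint hS hx hSx ?_ hPB ?_
      · rw [← hABZ]; exact fun y hy => Or.inl (Or.inr hy)
      · rw [e, Set.union_comm A B, Set.union_assoc, Set.union_comm A]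
    have h₂ : CondIndepVars P A B (Z \ {x}) :=
      ih _ hlt hS' _ _ _ e.symm hAB (hAZ.mono_right Set.sdiff_subset)
        (hBZ.mono_right Set.sdiff_subset)
        fun a ha b hb hab => hadj a ha b hb (hab.mono Set.sdiff_subset)
    -- Contraction places `x` beside `A`; weak union moves it into the conditioning set.
    have h₃ := (h₁.symm.contraction h₂.symm).weak_union (W := {x}) Set.subset_union_left
    rw [Set.sdiff_union_self, Set.union_eq_self_of_subset_right
      (Set.singleton_subset_iff.2 hxZ)] at h₃
    exact h₃.symm.mono Set.subset_union_right le_rfl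
  have hBA : B ∪ A ∪ Z = S := by rw [Set.union_comm B A, hABZ]
  have hadj' : ∀ b ∈ B, ∀ a ∈ A, ¬ G.AugAdj S b a := fun b hb a ha hba => hadj a ha b hb hba.symm
  rcases (hABZ ▸ hx : x ∈ A ∪ B ∪ Z) with (hxA | hxB) | hxZ
  · exact left A B hABZ hAB hAZ hBZ hadj hxA
  · exact (left B A hBA hAB.symm hBZ hAZ hadj' hxB).symm
  -- For `x ∈ Z`, the clique `Pa(C)` cannot meet both `A` and `B`.
  · by_cases hPB : Disjoint (G.parents (G.component S x)) B
    · exact middle A B hABZ hAB hAZ hBZ hadj hxZ hPB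
    · refine (middle B A hBA hAB.symm hBZ hAZ hadj' hxZ ?_).symm
      obtain ⟨b, hbP, hbB⟩ := Set.not_disjoint_iff.1 hPB
      exact Set.disjoint_left.2 fun a haP haA =>
        hadj a haA b hbB (augAdj_of_mem_parents_component hx haP hbP)

end Augmented

end CausalGraph

namespace CausalGraph

variable {V : Type*} {G : CausalGraph V}

/-! ### Shortening open walks to open paths -/

section Walks

/-- A walk: like a path, but the nodes need not be distinct. -/
structure Walk (G : CausalGraph V) where
  length : ℕ
  node : ℕ → V
  edge : ℕ → EdgeKind
  hasEdge : ∀ i < length, G.HasEdge (edge i) (node i) (node (i + 1))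

/-- The `i`-th node of the walk is a collider. -/
def Walk.IsCollider (w : G.Walk) (i : ℕ) : Prop :=
  0 < i ∧ i < w.length ∧ (w.edge (i - 1)).IntoSecond ∧ (w.edge i).IntoFirst

/-- The walk is open given `Z` at its `i`-th node. -/
def Walk.IsOpenAt (w : G.Walk) (Z : Set V) (i : ℕ) : Prop :=
  (w.IsCollider i → w.node i ∈ G.ancestors Z) ∧ (¬ w.IsCollider i → w.node i ∉ Z)

theorem EdgeKind.eq_forward_of_not_intoFirst {e : EdgeKind} (h : ¬ e.IntoFirst) :
    e = .forward := by
  cases e <;> simp_all [EdgeKind.IntoFirst]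

theorem mem_ancestors_of_dir {Z : Set V} {x y : V} (h : G.dir x y) (hy : y ∈ G.ancestors Z) :
    x ∈ G.ancestors Z :=
  isAncestral_iff.1 (isAncestral_ancestors Z) x y h hy

/-- An open walk that leaves its `k`-th node along a directed edge follows directed edges until it
meets a collider. -/
theorem Walk.mem_ancestors_or_transGen {w : G.Walk} {Z : Set V}
    (hw : ∀ i ≤ w.length, w.IsOpenAt Z i) {j : ℕ} (hj : j ≤ w.length) (m k : ℕ)
    (hk : k + 1 + m = j) (he : w.edge k = .forward) :
    w.node k ∈ G.ancestors Z ∨ Relation.TransGen G.dir (w.node k) (w.node j) := by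
  induction m generalizing k with
  | zero =>
    have := w.hasEdge k (by omega)
    rw [he] at this
    subst hk
    exact Or.inr (.single this)
  | succ m ih =>
    have hdir := w.hasEdge k (by omega)
    rw [he] at hdir
    by_cases hf : (w.edge (k + 1)).IntoFirst
    · exact Or.inl (mem_ancestors_of_dir hdir ((hw (k + 1) (by omega)).1
        ⟨by omega, by omega, Or.inl (by simpa using he), hf⟩))
    · rcases ih (k + 1) (by omega) (EdgeKind.eq_forward_of_not_intoFirst hf) with h | h
      · exact Or.inl (mem_ancestors_of_dir hdir h)
      · exact Or.inr (.head hdir h)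

/-- Cutting out the closed segment changes only the junction. If it is a non-collider afterwards,
one of its two occurrences was one, so it is not in `Z`. If it becomes a collider, either it already
was one at `i`, or the segment left it along a directed edge and led to an open collider, a directed
return being excluded by acyclicity. -/
theorem Walk.exists_shorter {w : G.Walk} {Z : Set V} (hw : ∀ i ≤ w.length, w.IsOpenAt Z i)
    {i j : ℕ} (hij : i < j) (hj : j ≤ w.length) (h : w.node i = w.node j) :
    ∃ w' : G.Walk, w'.length < w.length ∧ w'.node 0 = w.node 0 ∧
      w'.node w'.length = w.node w.length ∧ ∀ k ≤ w'.length, w'.IsOpenAt Z k := by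
  obtain ⟨d, rfl⟩ : ∃ d, j = i + d := ⟨j - i, by omega⟩
  -- Node `i` is kept, but its outgoing edge is the one after `j`; hence `≤` for nodes and `<` for
  -- edges.
  refine ⟨⟨w.length - d, fun k => if k ≤ i then w.node k else w.node (k + d),
    fun k => if k < i then w.edge k else w.edge (k + d), fun k hk => ?_⟩, ?_, ?_, ?_,
    fun k hk => ?_⟩
  · rcases lt_trichotomy k i with hki | rfl | hki
    · simpa [hki, hki.le, Nat.succ_le_of_lt hki] using w.hasEdge k (by omega)
    · have := w.hasEdge (k + d) (by omega)
      rw [← h] at this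
      simpa [Nat.add_right_comm] using this
    · have := w.hasEdge (k + d) (by omega)
      simpa [hki.not_ge, hki.not_gt, show ¬ k + 1 ≤ i by omega, Nat.add_right_comm] using this
  · dsimp only
    omega
  · simp
  · dsimp only
    split_ifs with hle
    · rw [show w.length - d = i by omega, h]
      congr 1
      omega
    · congr 1
      omega
  · dsimp only at hk
    rcases lt_trichotomy k i with hki | rfl | hki
    · have hk' := hw k (by omega)
      simpa [IsOpenAt, IsCollider, hki, hki.le, show k - 1 < i by omega,
        show k < w.length - d by omega, show k < w.length by omega] using hk'
    · have hi := hw k (by omega)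
      have hj' := hw (k + d) hj
      simp only [IsOpenAt, IsCollider, le_refl, if_true, lt_irrefl, if_false] at hi hj' ⊢
      rw [← h] at hj'
      constructor
      · rintro ⟨h0, hlt, h₁, h₂⟩
        rw [if_pos (by omega)] at h₁
        by_cases hf : (w.edge k).IntoFirst
        · exact hi.1 ⟨h0, by omega, h₁, hf⟩
        · rcases Walk.mem_ancestors_or_transGen hw hj (d - 1) k (by omega)
            (EdgeKind.eq_forward_of_not_intoFirst hf) with h' | h'
          · exact h'
          · rw [← h] at h'
            exact absurd h' (G.acyclic _)
      · intro hc
        by_cases h0 : 0 < k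
        · rw [if_pos (by omega)] at hc
          by_cases hlt : k + d < w.length
          · by_cases h₁ : (w.edge (k - 1)).IntoSecond
            · exact hj'.2 fun hc' => hc ⟨h0, by omega, h₁, hc'.2.2.2⟩
            · exact hi.2 fun hc' => h₁ hc'.2.2.1
          · exact hj'.2 fun hc' => hlt hc'.2.1
        · exact hi.2 fun hc' => h0 hc'.1
    · have hk' := hw (k + d) (by omega)
      have e : k - 1 + d = k + d - 1 := by omega
      simpa [IsOpenAt, IsCollider, hki.not_ge, hki.not_gt, show ¬ k - 1 < i by omega, e,
        show k < w.length - d ↔ k + d < w.length by omega, show 0 < k by omega,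
        show 0 < k + d by omega] using hk'

theorem Walk.exists_path {Z : Set V} (w : G.Walk) (hw : ∀ i ≤ w.length, w.IsOpenAt Z i) :
    ∃ p : G.Path, p.node 0 = w.node 0 ∧ p.node p.length = w.node w.length ∧
      ¬ p.IsBlocked Z := by
  induction hn : w.length using Nat.strong_induction_on generalizing w with
  | _ n ih =>
  subst hn
  by_cases hinj : Set.InjOn w.node (Set.Iic w.length)
  · refine ⟨⟨w.length, w.node, w.edge, w.hasEdge, hinj⟩, rfl, rfl, ?_⟩
    rintro ⟨i, hi, ⟨hc, hd⟩ | ⟨hc, hZ⟩⟩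
    · obtain ⟨z, hz, hiz⟩ := (hw i hi).1 hc
      exact Set.disjoint_left.1 hd ⟨_, rfl, hiz⟩ hz
    · exact (hw i hi).2 hc hZ
  · obtain ⟨i, j, hij, hj, h⟩ : ∃ i j, i < j ∧ j ≤ w.length ∧ w.node i = w.node j := by
      simp only [Set.InjOn, Set.mem_Iic, not_forall] at hinj
      obtain ⟨i, hi, j, hj, h, hne⟩ := hinj
      rcases Nat.lt_or_gt_of_ne hne with hlt | hlt
      exacts [⟨i, j, hlt, hj, h⟩, ⟨j, i, hlt, hi, h.symm⟩]
    obtain ⟨w', hlt, h0, h1, hw'⟩ := w.exists_shorter hw hij hj h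
    obtain ⟨p, hp0, hp1, hp⟩ := ih _ hlt w' hw' rfl
    exact ⟨p, hp0.trans h0, hp1.trans h1, hp⟩

end Walks

/-! ### Reachability and from the local to the global property -/

section Reach

/-- `G.Reach A Z v h` means that some walk from `A` to `v` is open given `Z` at all its nodes
before the last one; `h` says that its last edge exists and has an arrowhead at `v`. -/
inductive Reach (G : CausalGraph V) (A Z : Set V) : V → Prop → Prop
  | base {a : V} : a ∈ A → Reach G A Z a False
  | step {v w : V} {h : Prop} (e : EdgeKind) : Reach G A Z v h → G.HasEdge e v w →
      (h ∧ e.IntoFirst → v ∈ G.ancestors Z) → (¬ (h ∧ e.IntoFirst) → v ∉ Z) →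
      Reach G A Z w e.IntoSecond

variable {A B Z : Set V}

theorem Reach.exists_walk {v : V} {h : Prop} (hr : G.Reach A Z v h) :
    ∃ w : G.Walk, w.node 0 ∈ A ∧ w.node w.length = v ∧ (∀ i < w.length, w.IsOpenAt Z i) ∧
      (h ↔ 0 < w.length ∧ (w.edge (w.length - 1)).IntoSecond) := by
  induction hr with
  | @base a ha =>
    exact ⟨⟨0, fun _ => a, fun _ => .forward, fun i hi => absurd hi (Nat.not_lt_zero i)⟩, ha, rfl,
      fun i hi => absurd hi (Nat.not_lt_zero i), by simp⟩
  | @step v u h e _ he hc hn ih =>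
    obtain ⟨w, h0, h1, hw, hh⟩ := ih
    refine ⟨⟨w.length + 1, fun k => if k ≤ w.length then w.node k else u,
      fun k => if k < w.length then w.edge k else e, fun k hk => ?_⟩, ?_, ?_, fun k hk => ?_, ?_⟩
    · rcases (Nat.lt_succ_iff.1 hk).eq_or_lt with rfl | hlt
      · simpa [h1] using he
      · simpa [hlt, hlt.le, Nat.succ_le_of_lt hlt] using w.hasEdge k hlt
    · simpa using h0
    · simp
    · rcases (Nat.lt_succ_iff.1 hk).eq_or_lt with rfl | hlt
      · have key : (0 < w.length ∧ ((if w.length - 1 < w.length then w.edge (w.length - 1)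
            else e).IntoSecond ∧ e.IntoFirst)) ↔ h ∧ e.IntoFirst := by
          rw [hh, and_assoc]
          refine and_congr_right fun h => ?_
          rw [if_pos (by omega)]
        simp only [Walk.IsOpenAt, Walk.IsCollider, lt_irrefl, if_false, le_refl, if_true, h1,
          Nat.lt_succ_self, true_and, key]
        exact ⟨hc, hn⟩
      · simpa [Walk.IsOpenAt, Walk.IsCollider, hlt, hlt.le, show k - 1 < w.length by omega,
          show k < w.length + 1 by omega] using hw k hlt
    · simp

/-- `Reach` does not test the last node; an end of a walk is a non-collider, and `b ∉ Z` makes it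
open. -/
theorem DSeparated.not_reach (h : G.DSeparated A B Z) (hBZ : Disjoint B Z) {b : V} (hb : b ∈ B)
    (e : Prop) : ¬ G.Reach A Z b e := by
  intro hr
  obtain ⟨w, h0, h1, hw, -⟩ := hr.exists_walk
  obtain ⟨p, hp0, hp1, hp⟩ := w.exists_path (Z := Z) fun i hi => by
    rcases hi.eq_or_lt with rfl | hlt
    · exact ⟨fun hc => absurd hc.2.1 (lt_irrefl _),
        fun _ => h1 ▸ Set.disjoint_left.1 hBZ hb⟩
    · exact hw i hlt
  exact hp (h p (hp0 ▸ h0) (by rw [hp1, h1]; exact hb))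

/-- A walk from `A` reaches `v` and can be continued there by an edge with an arrowhead at `v`. -/
def Extendable (G : CausalGraph V) (A Z : Set V) (v : V) : Prop :=
  ∃ h, G.Reach A Z v h ∧ (h → v ∈ G.ancestors Z) ∧ (¬ h → v ∉ Z)

theorem Reach.of_reflTransGen {v b : V} {h : Prop} (hr : G.Reach A Z v h)
    (hv : v ∉ G.ancestors Z) (hvb : Relation.ReflTransGen G.dir v b) :
    ∃ h', G.Reach A Z b h' := by
  induction hvb using Relation.ReflTransGen.head_induction_on generalizing h with
  | refl => exact ⟨h, hr⟩
  | head hac _ ih =>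
    exact ih (Reach.step .forward hr hac (fun h => by simp [EdgeKind.IntoFirst] at h)
      fun _ hZ => hv (subset_ancestors Z hZ)) fun hc => hv (mem_ancestors_of_dir hac hc)

theorem exists_reach_of_mem_ancestors {v : V} (hA : v ∈ G.ancestors A) (hv : v ∉ G.ancestors Z) :
    ∃ h, ¬ h ∧ G.Reach A Z v h := by
  obtain ⟨a, ha, hva⟩ := hA
  induction hva using Relation.ReflTransGen.head_induction_on with
  | refl => exact ⟨False, id, .base ha⟩
  | head hac _ ih =>
    have hc := fun hc => hv (mem_ancestors_of_dir hac hc)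
    obtain ⟨h, hh, hr⟩ := ih hc
    exact ⟨_, by simp [EdgeKind.IntoSecond], Reach.step .backward hr hac (fun h' => absurd h'.1 hh)
      fun _ hZ => hc (subset_ancestors Z hZ)⟩

/-- Only a vertex outside `An(Z)` is in doubt. If it is an ancestor of `A`, it is reached afresh
against a directed path, arriving at a tail; if it is an ancestor of `B`, descending would reach
`B`. -/
theorem Reach.extendable (hB : ∀ b ∈ B, ∀ e, ¬ G.Reach A Z b e) {v : V} {h : Prop} (hr : G.Reach A Z v h)
    (hS : v ∈ G.ancestors (A ∪ B ∪ Z)) (hZ : ¬ h → v ∉ Z) : G.Extendable A Z v := by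
  by_cases hv : v ∈ G.ancestors Z
  · exact ⟨h, hr, fun _ => hv, hZ⟩
  · obtain ⟨y, (hy | hy) | hy, hvy⟩ := hS
    · obtain ⟨h', hh', hr'⟩ := exists_reach_of_mem_ancestors ⟨y, hy, hvy⟩ hv
      exact ⟨h', hr', fun h => absurd h hh', fun _ h => hv (subset_ancestors Z h)⟩
    · obtain ⟨h', hr'⟩ := hr.of_reflTransGen hv hvy
      exact absurd hr' (hB y hy h')
    · exact absurd ⟨y, hy, hvy⟩ hv

theorem Extendable.of_biStep (hB : ∀ b ∈ B, ∀ e, ¬ G.Reach A Z b e) {c d : V}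
    (hc : G.Extendable A Z c) (hcd : G.BiStep (G.ancestors (A ∪ B ∪ Z)) c d) :
    G.Extendable A Z d := by
  obtain ⟨h, hr, h₁, h₂⟩ := hc
  exact (Reach.step .bidirected hr hcd.2.2 (fun h => h₁ h.1)
    fun h' => h₂ fun h => h' ⟨h, Or.inr rfl⟩).extendable hB hcd.2.1
      fun h' => absurd (Or.inr rfl) h'

/-- Reachability by open walks is closed under adjacency in the augmented graph. -/
theorem Reach.of_augAdj (hB : ∀ b ∈ B, ∀ e, ¬ G.Reach A Z b e) {v u : V} {h : Prop}
    (hr : G.Reach A Z v h) (hv : v ∉ Z) (hvu : G.AugAdj (G.ancestors (A ∪ B ∪ Z)) v u) :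
    ∃ h', G.Reach A Z u h' := by
  obtain ⟨c, d, hc, hcd, hvc, hud⟩ := hvu
  have hc' : G.Extendable A Z c := by
    rcases hvc with hvc | ⟨_, rfl, hvc⟩
    · rw [Set.mem_singleton_iff] at hvc
      subst hvc
      exact hr.extendable hB hc fun _ => hv
    · exact (Reach.step .forward hr hvc (fun h => by simp [EdgeKind.IntoFirst] at h)
        fun _ => hv).extendable hB hc fun h' => absurd (Or.inl rfl) h'
  have hd : G.Extendable A Z d := by
    clear hud
    induction hcd with
    | refl => exact hc'
    | tail _ hbd ih => exact ih.of_biStep hB hbd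
  obtain ⟨h', hr', h₁, h₂⟩ := hd
  rcases hud with hud | ⟨_, rfl, hud⟩
  · rw [Set.mem_singleton_iff] at hud
    subst hud
    exact ⟨h', hr'⟩
  · exact ⟨_, Reach.step .backward hr' hud (fun h => h₁ h.1)
      fun h'' => h₂ fun h => h'' ⟨h, Or.inl rfl⟩⟩

theorem CComponentLocalMarkov.globalMarkov [Finite V] {α : V → Type*}
    [∀ v, MeasurableSpace (α v)] [∀ v, StandardBorelSpace (α v)] {prec : V → V → Prop}
    (hprec : G.IsConsistentOrdering prec) {P : Measure (∀ v, α v)} [IsProbabilityMeasure P]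
    (h : G.CComponentLocalMarkov prec P) : G.GlobalMarkov P := by
  intro A B Z hAB hAZ hBZ _ _ hsep
  have hB : ∀ b ∈ B, ∀ e, ¬ G.Reach A Z b e := fun b hb e => hsep.not_reach hBZ hb e
  set S := G.ancestors (A ∪ B ∪ Z)
  have hS : A ∪ B ∪ Z ⊆ S := subset_ancestors _
  set R := {v | ∃ e, G.Reach A Z v e}
  -- Reached and unreached vertices of `S \ Z` are never adjacent, and with `Z` they exhaust `S`.
  have hci : CondIndepVars P ((S ∩ R) \ Z) ((S \ R) \ Z) Z := by
    refine h.condIndepVars_of_not_augAdj hprec S (isAncestral_ancestors _) _ _ _ ?_ ?_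
      Set.disjoint_sdiff_left Set.disjoint_sdiff_left ?_
    · rw [← Set.union_sdiff_distrib, Set.inter_union_sdiff, Set.sdiff_union_self]
      exact Set.union_eq_self_of_subset_right fun z hz => hS (Or.inr hz)
    · exact Set.disjoint_left.2 fun v hv hv' => hv'.1.2 hv.1.2
    · rintro a ⟨⟨-, e, ha⟩, haZ⟩ b ⟨⟨-, hbR⟩, -⟩ hab
      exact hbR (ha.of_augAdj hB haZ hab)
  refine hci.mono (fun a ha => ?_) fun b hb => ?_
  · exact ⟨⟨hS (Or.inl (Or.inl ha)), _, .base ha⟩, Set.disjoint_left.1 hAZ ha⟩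
  · exact ⟨⟨hS (Or.inl (Or.inr hb)), fun ⟨e, he⟩ => hB b hb e he⟩, Set.disjoint_left.1 hBZ hb⟩

end Reach

end CausalGraph

theorem mainTheorem1 {V : Type*} [Finite V] {α : V → Type*} [∀ v, MeasurableSpace (α v)]
    [∀ v, StandardBorelSpace (α v)] (G : CausalGraph V) (prec : V → V → Prop)
    (hprec : G.IsConsistentOrdering prec) (P : MeasureTheory.Measure (∀ v, α v))
    [MeasureTheory.IsProbabilityMeasure P] :
    G.GlobalMarkov P ↔ G.CComponentLocalMarkov prec P :=
  ⟨fun h => h.cComponentLocalMarkov hprec, fun h => h.globalMarkov hprec⟩
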